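/- Let $m,n\in\mathbb N$, let $0<\varepsilon<\frac15$, and let $F\subseteq\mathbb R^n$ be a nonempty closed set, with $\mathbb R^n$ carrying the Euclidean metric $d$. Let $(f^{(k)})_{|k|\le m}$ be a Whitney jet of order $m$ on $F$. That is, for every multi-index $k\in\mathbb N^n$ with $|k|\le m$ the function $f^{(k)}:F\to\mathbb R$ is continuous, and, with $$P^{k}_y(x):=\sum_{|k+l|\le m}\frac{1}{l!}\,f^{(k+l)}(y)\,(x-y)^{l}\qquad (y\in F,\ x\in\mathbb R^n),$$ there is $M>0$ such that $|f^{(k)}(x)-P^{k}_y(x)|\le M\,d(x,y)^{m-|k|+1}$ for all $x,y\in F$ and all $|k|\le m$. Write $f:=f^{(0)}$ and $P_y:=P^{0}_y$. Let $\mathcal F$ be any family of closed dyadic cubes $Q=\prod_{i=1}^n[j_i2^{-s},(j_i+1)2^{-s}]$ ($s\in\mathbb Z$, $j\in\mathbb Z^n$) such that $\bigcup_{Q\in\mathcal F}Q=\mathbb R^n\setminus F$, distinct cubes of $\mathcal F$ have disjoint interiors, and $\frac12\operatorname{diam}(Q)<d(Q,F)<5\operatorname{diam}(Q)$ for every $Q\in\mathcal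 F$. For every $Q\in\mathcal F$ let $r_Q\in F$ be any point with $d(r_Q,Q)<5\operatorname{diam}(Q)$. Let $\lambda(t)=e^{-1/t}$ for $t>0$ and $\lambda(t)=0$ for $t\le0$, and put $$\mu(t)=\frac{\lambda(t)}{\lambda(t)+\lambda(1-t)},\qquad \nu(t)=\mu\Big(\frac{2t+1+\varepsilon}{\varepsilon}\Big)\,\mu\Big(\frac{1+\varepsilon-2t}{\varepsilon}\Big),\qquad \varphi_0(x)=\prod_{i=1}^n\nu(x_i).$$ For a cube $Q$ with center $c_Q$ and edge length $l_Q$ let $\varphi_Q(x)=\varphi_0\big((x-c_Q)/l_Q\big)$, and for $Q\in\mathcal F$ and $x\notin F$ let $\varphi^*_Q(x)=\varphi_Q(x)/\sum_{Q'\in\mathcal F}\varphi_{Q'}(x)$. Define $$g(x)=\begin{cases} f(x) & \text{if } x\in F,\\[2pt] \displaystyle\sum_{Q\in\mathcal F}P_{r_Q}(x)\,\varphi^*_Q(x) & \text{if } x\notin F.\end{cases}$$ Then $g$ is of class $C^m$ on $\mathbb R^n$, $\partial_k g(x)=f^{(k)}(x)$ for all $x\in F$ and all multi-indices $k$ with $|k|\le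 m$, and $g$ is of class $C^\infty$ on $\mathbb R^n\setminus F$. -/

import Mathlib

open scoped ContDiff

namespace WhitneyExtension

noncomputable section

/-! ### Multi-indices and iterated partial derivatives -/

/-- The order `|k| = k₁ + ⋯ + kₙ` of a multi-index. -/
def order {n : ℕ} (k : Fin n → ℕ) : ℕ := ∑ i, k i

/-- The partial derivative `∂g/∂xᵢ`. -/
def partialDeriv {n : ℕ} (i : Fin n) (g : EuclideanSpace ℝ (Fin n) → ℝ) :
    EuclideanSpace ℝ (Fin n) → ℝ :=
  fun x => lineDeriv ℝ g x (EuclideanSpace.single i 1)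

/-- The iterated partial derivative `∂^{|k|} g / ∂x₁^{k₁} ⋯ ∂xₙ^{kₙ}`. -/
def iteratedPartialDeriv {n : ℕ} (k : Fin n → ℕ) (g : EuclideanSpace ℝ (Fin n) → ℝ) :
    EuclideanSpace ℝ (Fin n) → ℝ :=
  (List.finRange n).foldr (fun i h => (partialDeriv i)^[k i] h) g

/-! ### Whitney jets

A jet of order `m` on `F` is given by functions `f k`, `|k| ≤ m`, on `F`. They are represented by
functions on the whole space, of which only the values on `F` for `|k| ≤ m` are ever used. -/

/-- The polynomial `P^k_y(x) = ∑_{|k + l| ≤ m} f^{(k + l)}(y) (x - y)^l / l!`. -/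
def taylorPoly {n : ℕ} (m : ℕ) (f : (Fin n → ℕ) → EuclideanSpace ℝ (Fin n) → ℝ)
    (k : Fin n → ℕ) (y x : EuclideanSpace ℝ (Fin n)) : ℝ :=
  ∑ l ∈ (Finset.Iic (fun _ : Fin n => m)).filter (fun l => order (k + l) ≤ m),
    (1 / (∏ i, ((l i).factorial : ℝ))) * (f (k + l) y * ∏ i, (x i - y i) ^ l i)

/-- Whitney jets of order `m` on `F`: continuous functions satisfying the compatibility
conditions, with one constant `M` for all orders and all pairs of points of `F`. -/
def IsWhitneyJet {n : ℕ} (m : ℕ) (F : Set (EuclideanSpace ℝ (Fin n)))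
    (f : (Fin n → ℕ) → EuclideanSpace ℝ (Fin n) → ℝ) : Prop :=
  (∀ k, order k ≤ m → ContinuousOn (f k) F) ∧
  ∃ M : ℝ, 0 < M ∧ ∀ k, order k ≤ m → ∀ x ∈ F, ∀ y ∈ F,
    |f k x - taylorPoly m f k y x| ≤ M * dist x y ^ (m - order k + 1)

/-! ### Dyadic cubes and decompositions of the complement of `F` -/

/-- The dyadic cube `∏ᵢ [jᵢ 2^{-s}, (jᵢ + 1) 2^{-s}]`, given by `s ∈ ℤ` and `j ∈ ℤⁿ`. -/
@[ext]
structure DyadicCube (n : ℕ) where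
  scale : ℤ
  corner : Fin n → ℤ

namespace DyadicCube

/-- The edge length. -/
def side {n : ℕ} (Q : DyadicCube n) : ℝ := (2 : ℝ) ^ (-Q.scale)

/-- The closed cube as a set of points. -/
def toSet {n : ℕ} (Q : DyadicCube n) : Set (EuclideanSpace ℝ (Fin n)) :=
  {x | ∀ i, (Q.corner i : ℝ) * Q.side ≤ x i ∧ x i ≤ ((Q.corner i : ℝ) + 1) * Q.side}

/-- The center. -/
def center {n : ℕ} (Q : DyadicCube n) : EuclideanSpace ℝ (Fin n) :=
  WithLp.toLp 2 (fun i => ((Q.corner i : ℝ) + 1 / 2) * Q.side)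

end DyadicCube

/-- The distance `inf {d(a, b) | a ∈ A, b ∈ B}` of two nonempty sets. -/
def setDist {X : Type*} [MetricSpace X] (A B : Set X) : ℝ := sInf (Set.image2 dist A B)

/-- The families of dyadic cubes that cover exactly the complement of `F`, have pairwise disjoint
interiors, and whose diameters are comparable to their distances from `F`. -/
def CUBE {n : ℕ} (F : Set (EuclideanSpace ℝ (Fin n))) : Set (Set (DyadicCube n)) :=
  {𝓕 | (⋃ Q ∈ 𝓕, Q.toSet) = Fᶜ ∧
    (∀ Q ∈ 𝓕, ∀ Q' ∈ 𝓕, Q ≠ Q' → interior Q.toSet ∩ interior Q'.toSet = ∅) ∧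
    (∀ Q ∈ 𝓕, 1 / 2 * Metric.diam Q.toSet < setDist Q.toSet F ∧
      setDist Q.toSet F < 5 * Metric.diam Q.toSet)}

/-! ### The partition of unity -/

/-- The one-dimensional bump function, equal to `1` on `[-1/2, 1/2]` and to `0` outside
`[-1/2 - ε/2, 1/2 + ε/2]`. Here `Real.smoothTransition t = λ(t) / (λ(t) + λ(1 - t))` with
`λ(t) = exp(-1/t)` for `t > 0` and `λ(t) = 0` for `t ≤ 0`. -/
def bump (ε t : ℝ) : ℝ :=
  Real.smoothTransition ((2 * t - (-1 - ε)) / ε) * Real.smoothTransition (((1 + ε) - 2 * t) / ε)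

/-- The bump function of the unit cube centered at the origin. -/
def unitBump {n : ℕ} (ε : ℝ) (x : EuclideanSpace ℝ (Fin n)) : ℝ := ∏ i, bump ε (x i)

/-- The bump function `φ_Q` of a cube. -/
def cubeBump {n : ℕ} (ε : ℝ) (Q : DyadicCube n) (x : EuclideanSpace ℝ (Fin n)) : ℝ :=
  unitBump ε (Q.side⁻¹ • (x - Q.center))

/-- The normalized function `φ*_Q = φ_Q / ∑_{Q' ∈ 𝓕} φ_{Q'}`, used off `F` only, where all but
finitely many terms of the sum vanish. -/
def normalizedBump {n : ℕ} (ε : ℝ) (𝓕 : Set (DyadicCube n)) (Q : DyadicCube n)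
    (x : EuclideanSpace ℝ (Fin n)) : ℝ :=
  cubeBump ε Q x / ∑ᶠ Q' : 𝓕, cubeBump ε Q'.1 x

/-! ### The extension -/

open Classical in
/-- The extension determined by a family of cubes `𝓕` and points `r Q`, `Q ∈ 𝓕`. -/
def extension {n : ℕ} (ε : ℝ) (m : ℕ) (F : Set (EuclideanSpace ℝ (Fin n)))
    (f : (Fin n → ℕ) → EuclideanSpace ℝ (Fin n) → ℝ) (𝓕 : Set (DyadicCube n))
    (r : DyadicCube n → EuclideanSpace ℝ (Fin n)) (x : EuclideanSpace ℝ (Fin n)) : ℝ :=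
  if x ∈ F then f 0 x
  else ∑ᶠ Q : 𝓕, taylorPoly m f 0 (r Q.1) x * normalizedBump ε 𝓕 Q.1 x

/-- All the extensions `g` of the jet `f`, for all decompositions `𝓕 ∈ CUBE F` and all choices of
approximate projections `r Q ∈ F` with `d(r Q, Q) < 5 diam Q`. -/
def WET {n : ℕ} (ε : ℝ) (m : ℕ) (F : Set (EuclideanSpace ℝ (Fin n)))
    (f : (Fin n → ℕ) → EuclideanSpace ℝ (Fin n) → ℝ) : Set (EuclideanSpace ℝ (Fin n) → ℝ) :=
  {g | ∃ 𝓕 ∈ CUBE F, ∃ r : DyadicCube n → EuclideanSpace ℝ (Fin n),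
    (∀ Q ∈ 𝓕, r Q ∈ F ∧ Metric.infDist (r Q) Q.toSet < 5 * Metric.diam Q.toSet) ∧
    g = extension ε m F f 𝓕 r}

end

end WhitneyExtension

/-! Everything rests on one estimate: for `x` in the whole space, `a ∈ F` and `j ≤ m`, the `j`-th
derivative of `g - P_a` at `x` is `O(d(x,a)^(m+1-j))`, uniformly in `x` and `a`. On `F` the
derivative of `g` is read as that of `P_x` at `x`, the value it is meant to have.

Off `F`, take first `a` nearest to `x` and `ρ` a multiple of `d(x,a)`. As the `φ*_Q` sum to `1`,
near `x` one has `g - P_a = ∑ (P_{r_Q} - P_a) φ*_Q`. The number of cubes involved is bounded in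
terms of `n` alone, their edges are comparable to `ρ`, and the points `r_Q` lie within `ρ` of `x`
and `a`. Re-expanding `P_a` at `r_Q` turns the jet condition into `D^j(P_{r_Q} - P_a) =
O(ρ^(m+1-j))` (`IsWhitneyJet.exists_derivBound_sub`), while `D^j φ*_Q = O(ρ^(-j))`. The predicate
`DerivBound` records such scaled bounds and is stable under sums, products and composition. A
general `a` is reached by comparing with the nearest point.

For `j < m` the exponent is at least `2`, so at `a ∈ F` the candidate `j`-th derivative is
differentiable, with the derivative of `D^j P_a`; for `j ≤ m` it is at least `1`, which gives
continuity. Hence the candidates form a Taylor series of `g`, and the partial derivatives on `F` are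
those of `P_a` at `a`, namely the jet. -/

namespace WhitneyExtension

noncomputable section

/-! ### Scaled bounds for derivatives at a point -/

section DerivBound

variable {E : Type*} [NormedAddCommGroup E] [NormedSpace ℝ E]

/-- `f` is of class `C^N`, and its derivatives of order `j ≤ N` at `x` are bounded by
`A * ρ ^ (-j)`. -/
def DerivBound (N : ℕ) (ρ A : ℝ) (f : E → ℝ) (x : E) : Prop :=
  ContDiff ℝ N f ∧ ∀ j ≤ N, ‖iteratedFDeriv ℝ j f x‖ * ρ ^ j ≤ A

theorem norm_iteratedFDeriv_affine_le {ρ A : ℝ} {x : E} (L : E →L[ℝ] ℝ) (b : ℝ) (hA : 0 ≤ A)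
    (hL : ‖L‖ * ρ ≤ A) {j : ℕ} (hj : 1 ≤ j) :
    ‖iteratedFDeriv ℝ j (fun y => L y + b) x‖ * ρ ^ j ≤ A := by
  obtain ⟨j, rfl⟩ := Nat.exists_eq_add_of_le' hj
  rw [← norm_iteratedFDeriv_fderiv]
  have : fderiv ℝ (fun y => L y + b) = fun _ => L := by
    ext1 y
    rw [fderiv_add_const]
    exact L.fderiv
  rw [this]
  rcases j with _ | j
  · simpa using hL
  · rw [iteratedFDeriv_succ_const]
    simpa using hA

namespace DerivBound

variable {N : ℕ} {ρ A B : ℝ} {f g : E → ℝ} {x : E}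

theorem nonneg (h : DerivBound N ρ A f x) : 0 ≤ A := by
  have := h.2 0 (Nat.zero_le _)
  simp only [pow_zero, mul_one] at this
  exact (norm_nonneg _).trans this

theorem mono (h : DerivBound N ρ A f x) (hAB : A ≤ B) : DerivBound N ρ B f x :=
  ⟨h.1, fun j hj => (h.2 j hj).trans hAB⟩

theorem rescale {c ρ' : ℝ} (h : DerivBound N ρ A f x) (hρ' : 0 ≤ ρ') (hρ : 0 ≤ ρ) (hc : 1 ≤ c)
    (hρρ' : ρ' ≤ c * ρ) : DerivBound N ρ' (c ^ N * A) f x := by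
  refine ⟨h.1, fun j hj => ?_⟩
  calc ‖iteratedFDeriv ℝ j f x‖ * ρ' ^ j ≤ ‖iteratedFDeriv ℝ j f x‖ * (c * ρ) ^ j := by gcongr
    _ = c ^ j * (‖iteratedFDeriv ℝ j f x‖ * ρ ^ j) := by rw [mul_pow]; ring
    _ ≤ c ^ N * A := by
      have := h.2 j hj
      have h2 : c ^ j ≤ c ^ N := pow_le_pow_right₀ hc hj
      gcongr

theorem const (c : ℝ) : DerivBound N ρ |c| (fun _ : E => c) x := by
  refine ⟨contDiff_const, fun j hj => ?_⟩
  rcases j with _ | j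
  · simp
  · rw [iteratedFDeriv_succ_const]
    simp

/-- Leibniz's rule distributes `ρ ^ j` over the two factors, and the binomial coefficients add up to
`2 ^ j ≤ 2 ^ N`; no power of `ρ` is lost. -/
theorem mul (hρ : 0 ≤ ρ) (hf : DerivBound N ρ A f x) (hg : DerivBound N ρ B g x) :
    DerivBound N ρ (2 ^ N * (A * B)) (fun y => f y * g y) x := by
  refine ⟨hf.1.mul hg.1, fun j hj => ?_⟩
  have hA := hf.nonneg
  have hB := hg.nonneg
  calc ‖iteratedFDeriv ℝ j (fun y => f y * g y) x‖ * ρ ^ j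
      ≤ (∑ i ∈ Finset.range (j + 1), (j.choose i : ℝ) * ‖iteratedFDeriv ℝ i f x‖ *
          ‖iteratedFDeriv ℝ (j - i) g x‖) * ρ ^ j := by
        gcongr
        exact norm_iteratedFDeriv_mul_le hf.1 hg.1 x (by exact_mod_cast hj)
    _ = ∑ i ∈ Finset.range (j + 1), (j.choose i : ℝ) * ((‖iteratedFDeriv ℝ i f x‖ * ρ ^ i) *
          (‖iteratedFDeriv ℝ (j - i) g x‖ * ρ ^ (j - i))) := by
        rw [Finset.sum_mul]
        refine Finset.sum_congr rfl fun i hi => ?_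
        have : ρ ^ j = ρ ^ i * ρ ^ (j - i) := by
          rw [← pow_add, Nat.add_sub_cancel' (Nat.lt_succ_iff.1 (Finset.mem_range.1 hi))]
        rw [this]; ring
    _ ≤ ∑ i ∈ Finset.range (j + 1), (j.choose i : ℝ) * (A * B) := by
        refine Finset.sum_le_sum fun i hi => ?_
        have h1 := hf.2 i ((Nat.lt_succ_iff.1 (Finset.mem_range.1 hi)).trans hj)
        have h2 := hg.2 (j - i) ((Nat.sub_le _ _).trans hj)
        gcongr
    _ = 2 ^ j * (A * B) := by
        rw [← Finset.sum_mul]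
        congr 1
        exact_mod_cast Nat.sum_range_choose j
    _ ≤ 2 ^ N * (A * B) := by
        gcongr
        norm_num

theorem const_mul (h : DerivBound N ρ A f x) (c : ℝ) :
    DerivBound N ρ (|c| * A) (fun y => c * f y) x := by
  refine ⟨contDiff_const.mul h.1, fun j hj => ?_⟩
  have : iteratedFDeriv ℝ j (fun y => c * f y) x = c • iteratedFDeriv ℝ j f x := by
    rw [← iteratedFDeriv_const_smul_apply (h.1.contDiffAt.of_le (by exact_mod_cast hj))]
    rfl
  rw [this, norm_smul, Real.norm_eq_abs, mul_assoc]
  have := h.2 j hj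
  gcongr

theorem add (hf : DerivBound N ρ A f x) (hg : DerivBound N ρ B g x) (hρ : 0 ≤ ρ) :
    DerivBound N ρ (A + B) (fun y => f y + g y) x := by
  refine ⟨hf.1.add hg.1, fun j hj => ?_⟩
  have hj' : (j : WithTop ℕ∞) ≤ N := by exact_mod_cast hj
  have : iteratedFDeriv ℝ j (fun y => f y + g y) x =
      iteratedFDeriv ℝ j f x + iteratedFDeriv ℝ j g x :=
    iteratedFDeriv_add_apply (hf.1.contDiffAt.of_le hj') (hg.1.contDiffAt.of_le hj')
  rw [this]
  calc _ ≤ (‖iteratedFDeriv ℝ j f x‖ + ‖iteratedFDeriv ℝ j g x‖) * ρ ^ j := by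
        gcongr; exact norm_add_le _ _
    _ ≤ A + B := by
        rw [add_mul]; exact add_le_add (hf.2 j hj) (hg.2 j hj)

theorem sum {ι : Type*} (s : Finset ι) {f : ι → E → ℝ} {A : ι → ℝ} (hρ : 0 ≤ ρ)
    (h : ∀ i ∈ s, DerivBound N ρ (A i) (f i) x) :
    DerivBound N ρ (∑ i ∈ s, A i) (fun y => ∑ i ∈ s, f i y) x := by
  classical
  induction s using Finset.induction_on with
  | empty => simpa using const (N := N) (ρ := ρ) (x := x) 0
  | insert a s ha ih =>
    simp only [Finset.sum_insert ha]
    exact (h a (Finset.mem_insert_self _ _)).add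
      (ih fun i hi => h i (Finset.mem_insert_of_mem hi)) hρ

theorem prod {ι : Type*} (s : Finset ι) {f : ι → E → ℝ} {A : ι → ℝ} (hρ : 0 ≤ ρ)
    (h : ∀ i ∈ s, DerivBound N ρ (A i) (f i) x) :
    DerivBound N ρ (∏ i ∈ s, (2 ^ N * A i)) (fun y => ∏ i ∈ s, f i y) x := by
  classical
  induction s using Finset.induction_on with
  | empty => simpa using const (N := N) (ρ := ρ) (x := x) 1
  | insert a s ha ih =>
    simp only [Finset.prod_insert ha]
    refine ((h a (Finset.mem_insert_self _ _)).mul hρ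
      (ih fun i hi => h i (Finset.mem_insert_of_mem hi))).mono (le_of_eq (by ring))

theorem pow (hρ : 0 ≤ ρ) (h : DerivBound N ρ A f x) (k : ℕ) :
    DerivBound N ρ ((2 ^ N * A) ^ k) (fun y => f y ^ k) x := by
  simpa using prod (Finset.range k) hρ (fun _ _ => h)

/-- Faà di Bruno bound. Only derivatives of `f` of positive order are controlled, since for a bump
composed with an affine map the inner value is unbounded. The condition `1 ≤ A` turns `A / ρ ^ i`
into the geometric bound `(A / ρ) ^ i`. -/
theorem comp {w : ℝ → ℝ} (hw : ContDiff ℝ N w) (hρ : 0 < ρ) (hf : ContDiff ℝ N f)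
    (h : ∀ j, 1 ≤ j → j ≤ N → ‖iteratedFDeriv ℝ j f x‖ * ρ ^ j ≤ A)
    (hA : 1 ≤ A) {C : ℝ} (hC : ∀ i ≤ N, ‖iteratedFDeriv ℝ i w (f x)‖ ≤ C) :
    DerivBound N ρ (N.factorial * C * A ^ N) (fun y => w (f y)) x := by
  refine ⟨hw.comp hf, fun j hj => ?_⟩
  have hC0 : 0 ≤ C := (norm_nonneg _).trans (hC 0 (Nat.zero_le _))
  have key : ‖iteratedFDeriv ℝ j (w ∘ f) x‖ ≤ j.factorial * C * (A / ρ) ^ j := by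
    refine norm_iteratedFDeriv_comp_le hw hf (by exact_mod_cast hj) x
      (fun i hi => hC i (hi.trans hj)) fun i hi hij => ?_
    rw [div_pow, le_div_iff₀ (by positivity)]
    exact (h i hi (hij.trans hj)).trans (le_self_pow₀ hA (by omega))
  calc ‖iteratedFDeriv ℝ j (w ∘ f) x‖ * ρ ^ j ≤ (j.factorial * C * (A / ρ) ^ j) * ρ ^ j := by
        gcongr
    _ = j.factorial * C * A ^ j := by
        rw [div_pow]; field_simp
    _ ≤ N.factorial * C * A ^ N := by
        have : (j.factorial : ℝ) ≤ N.factorial := by exact_mod_cast Nat.factorial_le hj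
        have h2 : A ^ j ≤ A ^ N := pow_le_pow_right₀ hA hj
        gcongr

theorem affine (L : E →L[ℝ] ℝ) (b : ℝ) (hA : |L x + b| ≤ A) (hL : ‖L‖ * ρ ≤ A) :
    DerivBound N ρ A (fun y => L y + b) x := by
  refine ⟨by fun_prop, fun j hj => ?_⟩
  rcases j with _ | j
  · simpa using hA
  · exact norm_iteratedFDeriv_affine_le L b ((abs_nonneg _).trans hA) hL j.succ_pos

end DerivBound

end DerivBound

/-! ### Taylor polynomials -/

section Taylor

variable {n : ℕ}

theorem le_order (l : Fin n → ℕ) (i : Fin n) : l i ≤ order l :=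
  Finset.single_le_sum (f := l) (fun _ _ => Nat.zero_le _) (Finset.mem_univ i)

theorem order_add (k l : Fin n → ℕ) : order (k + l) = order k + order l := by
  simp [order, Finset.sum_add_distrib]

theorem mem_multiIndices {m : ℕ} {k l : Fin n → ℕ} :
    l ∈ (Finset.Iic (fun _ : Fin n => m)).filter (fun l => order (k + l) ≤ m) ↔
      order (k + l) ≤ m := by
  rw [Finset.mem_filter, Finset.mem_Iic, and_iff_right_iff_imp]
  intro h i
  have := le_order l i
  rw [order_add] at h
  change l i ≤ m
  omega

theorem add_pow_div_factorial (u v : ℝ) (k : ℕ) :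
    (u + v) ^ k / (k.factorial : ℝ) = ∑ p ∈ Finset.HasAntidiagonal.antidiagonal k,
      (u ^ p.1 / (p.1.factorial : ℝ)) * (v ^ p.2 / (p.2.factorial : ℝ)) := by
  rw [(Commute.all u v).add_pow', Finset.sum_div]
  refine Finset.sum_congr rfl fun p hp => ?_
  rw [Finset.HasAntidiagonal.mem_antidiagonal] at hp
  have h : ((p.1 + p.2).choose p.1 : ℝ) * p.1.factorial * p.2.factorial =
      (p.1 + p.2).factorial := by
    rw [Nat.choose_symm_add]
    exact_mod_cast Nat.add_choose_mul_factorial_mul_factorial p.1 p.2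
  have h1 : (p.1.factorial : ℝ) ≠ 0 := by positivity
  have h2 : (p.2.factorial : ℝ) ≠ 0 := by positivity
  have h3 : (k.factorial : ℝ) ≠ 0 := by positivity
  rw [hp] at h
  rw [nsmul_eq_mul]
  field_simp
  rw [← h]
  ring

/-- `P_a` has degree at most `m`, so its Taylor expansion at `r` is exact, with coefficients
`P^l_a(r)`. Algebraically: apply the binomial theorem to `x - a = (x - r) + (r - a)` in each
coordinate. -/
theorem taylorPoly_reexpand (m : ℕ) (f : (Fin n → ℕ) → EuclideanSpace ℝ (Fin n) → ℝ)
    (a r x : EuclideanSpace ℝ (Fin n)) :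
    taylorPoly m f 0 a x =
      ∑ l ∈ (Finset.Iic (fun _ : Fin n => m)).filter (fun l => order (0 + l) ≤ m),
        (1 / (∏ i, ((l i).factorial : ℝ))) *
          (taylorPoly m f l a r * ∏ i, (x i - r i) ^ l i) := by
  have lhs : taylorPoly m f 0 a x =
      ∑ k ∈ (Finset.Iic (fun _ : Fin n => m)).filter (fun l => order (0 + l) ≤ m),
        ∑ p ∈ Fintype.piFinset (fun i => Finset.HasAntidiagonal.antidiagonal (k i)),
          f k a * ∏ i, (((x i - r i) ^ (p i).1 / ((p i).1.factorial : ℝ)) *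
            ((r i - a i) ^ (p i).2 / ((p i).2.factorial : ℝ))) := by
    refine Finset.sum_congr rfl fun k _ => ?_
    rw [← Finset.mul_sum, zero_add, ← Finset.prod_univ_sum
      (fun i => Finset.HasAntidiagonal.antidiagonal (k i))
      (fun i p => (x i - r i) ^ p.1 / (p.1.factorial : ℝ) *
        ((r i - a i) ^ p.2 / (p.2.factorial : ℝ)))]
    simp_rw [← add_pow_div_factorial, sub_add_sub_cancel, Finset.prod_div_distrib]
    ring
  rw [lhs]
  simp_rw [taylorPoly, Finset.sum_mul, Finset.mul_sum]
  rw [Finset.sum_sigma', Finset.sum_sigma']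
  -- Choosing `k` with a coordinatewise splitting `k = l + l'` is the same as choosing `(l, l')`
  -- with `|l + l'| ≤ m`.
  refine Finset.sum_bij'
    (i := fun q _ => ⟨fun i => (q.2 i).1, fun i => (q.2 i).2⟩)
    (j := fun q _ => ⟨q.1 + q.2, fun i => (q.1 i, q.2 i)⟩) ?_ ?_ ?_ ?_ ?_
  · rintro ⟨k, p⟩ h
    simp only [Finset.mem_sigma, mem_multiIndices, Fintype.mem_piFinset,
      Finset.HasAntidiagonal.mem_antidiagonal] at h ⊢
    rw [zero_add] at h ⊢
    have hk : (fun i => (p i).1) + (fun i => (p i).2) = k := funext h.2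
    refine ⟨le_trans ?_ h.1, by rw [hk]; exact h.1⟩
    rw [← hk, order_add]
    exact Nat.le_add_right _ _
  · rintro ⟨l, l'⟩ h
    simp only [Finset.mem_sigma, mem_multiIndices, Fintype.mem_piFinset,
      Finset.HasAntidiagonal.mem_antidiagonal] at h ⊢
    exact ⟨by rw [zero_add]; exact h.2, fun _ => rfl⟩
  · rintro ⟨k, p⟩ h
    simp only [Finset.mem_sigma, Fintype.mem_piFinset, Finset.HasAntidiagonal.mem_antidiagonal] at h
    have hk : (fun i => (p i).1) + (fun i => (p i).2) = k := funext h.2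
    simp [hk]
  · rintro ⟨l, l'⟩ h
    rfl
  · rintro ⟨k, p⟩ h
    simp only [Finset.mem_sigma, Fintype.mem_piFinset, Finset.HasAntidiagonal.mem_antidiagonal] at h
    have hk : (fun i => (p i).1) + (fun i => (p i).2) = k := funext h.2
    simp only [hk, Finset.prod_mul_distrib, Finset.prod_div_distrib]
    ring

/-- The coefficients on the right are exactly the quantities bounded in the jet condition. -/
theorem taylorPoly_zero_self_sub (m : ℕ) (f : (Fin n → ℕ) → EuclideanSpace ℝ (Fin n) → ℝ)
    (a r x : EuclideanSpace ℝ (Fin n)) :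
    taylorPoly m f 0 r x - taylorPoly m f 0 a x =
      ∑ l ∈ (Finset.Iic (fun _ : Fin n => m)).filter (fun l => order (0 + l) ≤ m),
        ((1 / (∏ i, ((l i).factorial : ℝ))) * (f l r - taylorPoly m f l a r)) *
          ∏ i, (x i - r i) ^ l i := by
  rw [taylorPoly_reexpand m f a r x, taylorPoly, ← Finset.sum_sub_distrib]
  refine Finset.sum_congr rfl fun l _ => ?_
  rw [zero_add]
  ring

theorem contDiff_taylorPoly (m : ℕ) (f : (Fin n → ℕ) → EuclideanSpace ℝ (Fin n) → ℝ)
    (k : Fin n → ℕ) (a : EuclideanSpace ℝ (Fin n)) {N : WithTop ℕ∞} :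
    ContDiff ℝ N (taylorPoly m f k a) := by
  unfold taylorPoly
  fun_prop

theorem norm_proj_le (i : Fin n) :
    ‖(EuclideanSpace.proj i : EuclideanSpace ℝ (Fin n) →L[ℝ] ℝ)‖ ≤ 1 :=
  ContinuousLinearMap.opNorm_le_bound _ zero_le_one fun x => by
    simpa using PiLp.norm_apply_le x i

theorem derivBound_coord (N : ℕ) {ρ : ℝ} (hρ : 0 ≤ ρ) {x r : EuclideanSpace ℝ (Fin n)}
    (h : dist x r ≤ ρ) (i : Fin n) : DerivBound N ρ ρ (fun y => y i - r i) x := by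
  have := DerivBound.affine (N := N) (ρ := ρ) (A := ρ) (x := x)
    (EuclideanSpace.proj i : EuclideanSpace ℝ (Fin n) →L[ℝ] ℝ) (-r i) ?_ ?_
  · simpa [sub_eq_add_neg] using this
  · rw [dist_eq_norm] at h
    simpa [sub_eq_add_neg] using (PiLp.norm_apply_le (x - r) i).trans h
  · exact mul_le_of_le_one_left hρ (norm_proj_le i)

/-- Taylor polynomials of a Whitney jet at two points `r`, `a` of `F` are close, together with
their derivatives, near `r` and `a`. -/
theorem IsWhitneyJet.exists_derivBound_sub {m : ℕ} {F : Set (EuclideanSpace ℝ (Fin n))}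
    {f : (Fin n → ℕ) → EuclideanSpace ℝ (Fin n) → ℝ} (hf : IsWhitneyJet m F f) :
    ∃ C : ℝ, 0 ≤ C ∧ ∀ r ∈ F, ∀ a ∈ F, ∀ x ρ, 0 ≤ ρ → dist x r ≤ ρ → dist r a ≤ ρ →
      DerivBound m ρ (C * ρ ^ (m + 1))
        (fun y => taylorPoly m f 0 r y - taylorPoly m f 0 a y) x := by
  obtain ⟨-, M, hM, hfM⟩ := hf
  refine ⟨∑ l ∈ (Finset.Iic (fun _ : Fin n => m)).filter (fun l => order (0 + l) ≤ m),
    (1 / (∏ i, ((l i).factorial : ℝ))) * M * ∏ i, (2 ^ m * (2 ^ m) ^ l i), by positivity,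
    fun r hr a ha x ρ hρ hxr hra => ?_⟩
  simp_rw [taylorPoly_zero_self_sub, Finset.sum_mul]
  refine DerivBound.sum _ hρ fun l hl => ?_
  rw [mem_multiIndices, zero_add] at hl
  refine ((DerivBound.prod Finset.univ hρ fun i _ =>
    (derivBound_coord m hρ hxr i).pow hρ (l i)).const_mul _).mono ?_
  have h1 : ∏ i, (2 ^ m * (2 ^ m * ρ) ^ l i) = (∏ i, (2 ^ m * (2 ^ m : ℝ) ^ l i)) * ρ ^ order l := by
    simp_rw [mul_pow, ← mul_assoc]
    rw [Finset.prod_mul_distrib, order, Finset.prod_pow_eq_pow_sum]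
  have h2 : |f l r - taylorPoly m f l a r| ≤ M * ρ ^ (m - order l + 1) :=
    (hfM l hl r hr a ha).trans (by gcongr)
  -- The coefficient contributes the first power and the monomial the second, so every term has the
  -- same order `m + 1`. The truncated subtraction is harmless because `|l| ≤ m`.
  have h3 : ρ ^ (m + 1) = ρ ^ (m - order l + 1) * ρ ^ order l := by
    rw [← pow_add]; congr 1; omega
  rw [h1, h3, abs_mul, abs_of_nonneg (by positivity : (0 : ℝ) ≤ 1 / ∏ i, ((l i).factorial : ℝ))]
  calc _ ≤ 1 / (∏ i, ((l i).factorial : ℝ)) * (M * ρ ^ (m - order l + 1)) *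
        ((∏ i, (2 ^ m * (2 ^ m : ℝ) ^ l i)) * ρ ^ order l) := by gcongr
    _ = _ := by ring

end Taylor

/-! ### Iterated partial derivatives -/

section PartialDeriv

variable {n : ℕ}

/-- The operator `T` evaluates the derivative of order `N` at a fixed tuple of vectors. -/
def IsDerivEval (N : ℕ)
    (T : (EuclideanSpace ℝ (Fin n) → ℝ) → EuclideanSpace ℝ (Fin n) → ℝ) : Prop :=
  ∃ v : Fin N → EuclideanSpace ℝ (Fin n), ∀ h, ContDiff ℝ N h →
    T h = fun x => iteratedFDeriv ℝ N h x v

theorem IsDerivEval.partialDeriv {N : ℕ}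
    {T : (EuclideanSpace ℝ (Fin n) → ℝ) → EuclideanSpace ℝ (Fin n) → ℝ}
    (hT : IsDerivEval N T) (i : Fin n) :
    IsDerivEval (N + 1) (fun h => partialDeriv i (T h)) := by
  obtain ⟨v, hv⟩ := hT
  refine ⟨Fin.cons (EuclideanSpace.single i 1) v, fun h hh => ?_⟩
  ext x
  have hd : DifferentiableAt ℝ (iteratedFDeriv ℝ N h) x :=
    hh.contDiffAt.differentiableAt_iteratedFDeriv (by exact_mod_cast Nat.lt_succ_self N)
  rw [hd.iteratedFDeriv_succ_apply_left']
  have hd' : DifferentiableAt ℝ (fun x => iteratedFDeriv ℝ N h x v) x :=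
    ((ContinuousMultilinearMap.apply ℝ (fun _ : Fin N => EuclideanSpace ℝ (Fin n)) ℝ
      v).hasFDerivAt.comp x hd.hasFDerivAt).differentiableAt
  beta_reduce
  rw [hv h (hh.of_le (by exact_mod_cast Nat.le_succ N)), WhitneyExtension.partialDeriv,
    hd'.lineDeriv_eq_fderiv, Fin.tail_cons, Fin.cons_zero]

theorem IsDerivEval.iterate_partialDeriv {N : ℕ}
    {T : (EuclideanSpace ℝ (Fin n) → ℝ) → EuclideanSpace ℝ (Fin n) → ℝ}
    (hT : IsDerivEval N T) (i : Fin n) (k : ℕ) :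
    IsDerivEval (N + k) (fun h => (WhitneyExtension.partialDeriv i)^[k] (T h)) := by
  induction k with
  | zero => exact hT
  | succ k ih =>
    simp_rw [Function.iterate_succ_apply']
    exact ih.partialDeriv i

theorem isDerivEval_foldr (k : Fin n → ℕ) (L : List (Fin n)) :
    IsDerivEval (L.map k).sum (fun g => L.foldr (fun i h => (partialDeriv i)^[k i] h) g) := by
  induction L with
  | nil => exact ⟨Fin.elim0, fun h _ => rfl⟩
  | cons i L ih =>
    rw [List.map_cons, List.sum_cons, add_comm]
    exact ih.iterate_partialDeriv i (k i)

/-- Each partial derivative prepends a basis vector to the tuple. The tuple does not depend on the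
function, so equal `iteratedFDeriv` at a point force equal partial derivatives there. -/
theorem isDerivEval_iteratedPartialDeriv (k : Fin n → ℕ) :
    IsDerivEval (order k) (iteratedPartialDeriv k) := by
  have := isDerivEval_foldr k (List.finRange n)
  rwa [← List.ofFn_eq_map, List.sum_ofFn] at this

theorem partialDeriv_prod (i : Fin n) (H : Fin n → ℝ → ℝ) :
    partialDeriv i (fun x => ∏ j, H j (x j)) =
      fun x => ∏ j, Function.update H i (deriv (H i)) j (x j) := by
  ext x
  have h1 : ∀ t : ℝ, ∏ j, H j ((x + t • EuclideanSpace.single i (1 : ℝ)) j) =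
      H i (x i + t) * ∏ j ∈ Finset.univ.erase i, H j (x j) := by
    intro t
    rw [← Finset.mul_prod_erase _ _ (Finset.mem_univ i)]
    congr 1
    · simp
    · refine Finset.prod_congr rfl fun j hj => ?_
      simp [Finset.ne_of_mem_erase hj]
  rw [partialDeriv, lineDeriv]
  simp_rw [h1]
  rw [deriv_mul_const_field, deriv_comp_const_add, add_zero,
    ← Finset.mul_prod_erase _ _ (Finset.mem_univ i)]
  congr 1
  · simp
  · refine Finset.prod_congr rfl fun j hj => ?_
    simp [Finset.ne_of_mem_erase hj]

theorem iterate_partialDeriv_prod (i : Fin n) (H : Fin n → ℝ → ℝ) (k : ℕ) :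
    (partialDeriv i)^[k] (fun x => ∏ j, H j (x j)) =
      fun x => ∏ j, Function.update H i (deriv^[k] (H i)) j (x j) := by
  induction k with
  | zero => simp
  | succ k ih =>
    rw [Function.iterate_succ_apply', ih, partialDeriv_prod]
    simp [Function.iterate_succ_apply']

/-- Separation of variables: each index occurs once in the list, so each factor is differentiated
once, in a block of length `k j`. -/
theorem iteratedPartialDeriv_prod (k : Fin n → ℕ) (H : Fin n → ℝ → ℝ) :
    iteratedPartialDeriv k (fun x => ∏ j, H j (x j)) =
      fun x => ∏ j, (deriv^[k j] (H j)) (x j) := by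
  have key : ∀ L : List (Fin n), L.Nodup →
      L.foldr (fun i h => (partialDeriv i)^[k i] h)
        (fun x : EuclideanSpace ℝ (Fin n) => ∏ j, H j (x j)) =
      fun x => ∏ j, (if j ∈ L then deriv^[k j] (H j) else H j) (x j) := by
    intro L hL
    induction L with
    | nil => simp
    | cons i L ih =>
      rw [List.nodup_cons] at hL
      rw [List.foldr_cons, ih hL.2,
        iterate_partialDeriv_prod i (fun j => if j ∈ L then deriv^[k j] (H j) else H j)]
      ext x
      refine Finset.prod_congr rfl fun j _ => ?_
      by_cases hj : j = i
      · subst hj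
        simp [hL.1]
      · simp [hj]
  rw [iteratedPartialDeriv, key _ (List.nodup_finRange n)]
  simp

theorem iterate_deriv_sub_pow_self (a : ℝ) (k l : ℕ) :
    deriv^[k] (fun t : ℝ => (t - a) ^ l) a = if l = k then (k.factorial : ℝ) else 0 := by
  rw [← iteratedDeriv_eq_iterate, iteratedDeriv_comp_sub_const (f := fun t : ℝ => t ^ l)]
  beta_reduce
  rw [sub_self, iteratedDeriv_fun_pow_zero]
  by_cases h : k = l
  · simp [h]
  · simp [h, Ne.symm h]

theorem iteratedPartialDeriv_monomial_self (k l : Fin n → ℕ) (a : EuclideanSpace ℝ (Fin n)) :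
    iteratedPartialDeriv k (fun x => ∏ j, (x j - a j) ^ l j) a =
      if l = k then ∏ j, ((k j).factorial : ℝ) else 0 := by
  rw [iteratedPartialDeriv_prod k (fun j t => (t - a j) ^ l j)]
  simp_rw [iterate_deriv_sub_pow_self]
  split_ifs with h
  · simp [h]
  · obtain ⟨j, hj⟩ := Function.ne_iff.1 h
    exact Finset.prod_eq_zero (Finset.mem_univ j) (if_neg hj)

/-- At `a` the operator kills every monomial except that of index `k`, where it gives `k!`.
Linearity is borrowed from `iteratedFDeriv` through the fixed tuple `v`. -/
theorem iteratedPartialDeriv_taylorPoly_self {m : ℕ}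
    (f : (Fin n → ℕ) → EuclideanSpace ℝ (Fin n) → ℝ) {k : Fin n → ℕ} (hk : order k ≤ m)
    (a : EuclideanSpace ℝ (Fin n)) :
    iteratedPartialDeriv k (taylorPoly m f 0 a) a = f k a := by
  obtain ⟨v, hv⟩ := isDerivEval_iteratedPartialDeriv k
  have hmono : ∀ l : Fin n → ℕ,
      ContDiff ℝ (order k) fun x : EuclideanSpace ℝ (Fin n) => ∏ j, (x j - a j) ^ l j :=
    fun l => by fun_prop
  have hP : taylorPoly m f 0 a = fun x =>
      ∑ l ∈ (Finset.Iic (fun _ : Fin n => m)).filter (fun l => order (0 + l) ≤ m),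
        ((1 / (∏ i, ((l i).factorial : ℝ))) * f l a) • ∏ i, (x i - a i) ^ l i := by
    ext x
    simp [taylorPoly, mul_assoc]
  have h1 : ∀ l : Fin n → ℕ, iteratedFDeriv ℝ (order k)
      (fun x : EuclideanSpace ℝ (Fin n) => ∏ j, (x j - a j) ^ l j) a v =
        if l = k then ∏ j, ((k j).factorial : ℝ) else 0 := fun l => by
    rw [← iteratedPartialDeriv_monomial_self, hv _ (hmono l)]
  rw [hv _ (contDiff_taylorPoly m f 0 a), hP]
  beta_reduce
  rw [iteratedFDeriv_fun_sum_apply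
      (f := fun l (x : EuclideanSpace ℝ (Fin n)) =>
        ((1 / (∏ i, ((l i).factorial : ℝ))) * f l a) • ∏ i, (x i - a i) ^ l i)
      fun l _ => ((hmono l).const_smul ((1 / (∏ i, ((l i).factorial : ℝ))) * f l a)).contDiffAt,
    sum_apply]
  have h2 : ∀ (c : ℝ) (l : Fin n → ℕ), iteratedFDeriv ℝ (order k)
      (fun x : EuclideanSpace ℝ (Fin n) => c • ∏ j, (x j - a j) ^ l j) a v =
        c * if l = k then ∏ j, ((k j).factorial : ℝ) else 0 := fun c l => by
    rw [← h1, ← smul_eq_mul, ← smul_apply,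
      ← iteratedFDeriv_const_smul_apply (hmono l).contDiffAt]
    rfl
  simp_rw [h2]
  have hk' : k ∈ (Finset.Iic (fun _ : Fin n => m)).filter (fun l => order (0 + l) ≤ m) := by
    rw [mem_multiIndices, zero_add]; exact hk
  rw [Finset.sum_eq_single_of_mem k hk' fun l _ hl => by simp [hl]]
  have : (∏ i, ((k i).factorial : ℝ)) ≠ 0 := Finset.prod_ne_zero_iff.2 fun i _ => by positivity
  rw [if_pos rfl]
  field_simp

end PartialDeriv

/-! ### Bump functions -/

section Bump

theorem contDiff_bump (ε : ℝ) {N : ℕ∞} : ContDiff ℝ N (bump ε) := by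
  have h : ContDiff ℝ N Real.smoothTransition := Real.smoothTransition.contDiff
  exact (h.comp (by fun_prop)).mul (h.comp (by fun_prop))

theorem bump_nonneg (ε t : ℝ) : 0 ≤ bump ε t :=
  mul_nonneg (Real.smoothTransition.nonneg _) (Real.smoothTransition.nonneg _)

theorem bump_le_one (ε t : ℝ) : bump ε t ≤ 1 :=
  mul_le_one₀ (Real.smoothTransition.le_one _) (Real.smoothTransition.nonneg _)
    (Real.smoothTransition.le_one _)

variable {ε : ℝ}

theorem bump_eq_one (hε : 0 < ε) {t : ℝ} (ht : |t| ≤ 1 / 2) : bump ε t = 1 := by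
  rw [abs_le] at ht
  rw [bump, Real.smoothTransition.one_of_one_le, Real.smoothTransition.one_of_one_le, one_mul]
  all_goals
    rw [le_div_iff₀ hε]
    linarith

/-- The support ends at `(1 + ε) / 2`, which is below `3 / 5` as `ε < 1 / 5`. -/
theorem bump_eq_zero (hε : 0 < ε) (hε' : ε < 1 / 5) {t : ℝ} (ht : 3 / 5 ≤ |t|) :
    bump ε t = 0 := by
  rw [bump]
  rcases le_abs.1 ht with h | h
  · rw [Real.smoothTransition.zero_of_nonpos (x := ((1 + ε) - 2 * t) / ε), mul_zero]
    exact div_nonpos_of_nonpos_of_nonneg (by linarith) hε.le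
  · rw [Real.smoothTransition.zero_of_nonpos (x := (2 * t - (-1 - ε)) / ε), zero_mul]
    exact div_nonpos_of_nonpos_of_nonneg (by linarith) hε.le

theorem exists_norm_iteratedFDeriv_bump_le (hε : 0 < ε) (hε' : ε < 1 / 5) (N : ℕ) :
    ∃ B : ℝ, ∀ i ≤ N, ∀ t, ‖iteratedFDeriv ℝ i (bump ε) t‖ ≤ B := by
  have hsupp : HasCompactSupport (bump ε) :=
    HasCompactSupport.intro (K := Set.Icc (-1) 1) isCompact_Icc fun t ht =>
      bump_eq_zero hε hε' (by
        by_contra! h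
        rw [abs_lt] at h
        exact ht ⟨by linarith, by linarith⟩)
  have : ∀ i, ∃ B : ℝ, ∀ t, ‖iteratedFDeriv ℝ i (bump ε) t‖ ≤ B := fun i =>
    (hsupp.iteratedFDeriv i).exists_bound_of_continuous
      ((contDiff_bump ε (N := i)).continuous_iteratedFDeriv le_rfl)
  choose B hB using this
  refine ⟨∑ i ∈ Finset.range (N + 1), |B i|, fun i hi t => (hB i t).trans ((le_abs_self _).trans ?_)⟩
  exact Finset.single_le_sum (f := fun i => |B i|) (fun _ _ => abs_nonneg _)
    (Finset.mem_range.2 (Nat.lt_succ_of_le hi))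

end Bump

/-! ### Dyadic cubes -/

section Cubes

variable {n : ℕ}

namespace DyadicCube

theorem side_pos (Q : DyadicCube n) : 0 < Q.side := zpow_pos two_pos _

theorem center_apply (Q : DyadicCube n) (i : Fin n) :
    Q.center i = ((Q.corner i : ℝ) + 1 / 2) * Q.side := rfl

theorem mem_toSet_iff {Q : DyadicCube n} {x : EuclideanSpace ℝ (Fin n)} :
    x ∈ Q.toSet ↔ ∀ i, |x i - Q.center i| ≤ 1 / 2 * Q.side := by
  refine forall_congr' fun i => ?_
  rw [center_apply, abs_le]
  constructor
  · rintro ⟨h1, h2⟩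
    constructor <;> linarith
  · rintro ⟨h1, h2⟩
    constructor <;> linarith

theorem center_mem (Q : DyadicCube n) : Q.center ∈ Q.toSet :=
  mem_toSet_iff.2 fun i => by simpa using Q.side_pos.le

/-- The point `x` lies in the cube with the same center and `7 / 5` times the edge length. -/
def IsNear (Q : DyadicCube n) (x : EuclideanSpace ℝ (Fin n)) : Prop :=
  ∀ i, |x i - Q.center i| ≤ 7 / 10 * Q.side

end DyadicCube

open DyadicCube

theorem dist_le_sqrt_mul {x y : EuclideanSpace ℝ (Fin n)} {c : ℝ} (hc : 0 ≤ c)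
    (h : ∀ i, |x i - y i| ≤ c) : dist x y ≤ √n * c := by
  rw [EuclideanSpace.dist_eq]
  refine Real.sqrt_le_iff.2 ⟨by positivity, ?_⟩
  calc ∑ i, dist (x i) (y i) ^ 2 ≤ ∑ _i : Fin n, c ^ 2 :=
        Finset.sum_le_sum fun i _ => pow_le_pow_left₀ dist_nonneg (h i) 2
    _ = (√n * c) ^ 2 := by simp [mul_pow]

theorem abs_apply_sub_le (x y : EuclideanSpace ℝ (Fin n)) (i : Fin n) :
    |x i - y i| ≤ dist x y := by
  rw [dist_eq_norm]
  exact PiLp.norm_apply_le (x - y) i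

theorem dist_le_of_mem_toSet {Q : DyadicCube n} {x y : EuclideanSpace ℝ (Fin n)}
    (hx : x ∈ Q.toSet) (hy : y ∈ Q.toSet) : dist x y ≤ √n * Q.side :=
  dist_le_sqrt_mul Q.side_pos.le fun i => by
    have h1 := abs_le.1 (mem_toSet_iff.1 hx i)
    have h2 := abs_le.1 (mem_toSet_iff.1 hy i)
    exact abs_le.2 ⟨by linarith, by linarith⟩

theorem diam_toSet (Q : DyadicCube n) : Metric.diam Q.toSet = √n * Q.side := by
  refine le_antisymm (Metric.diam_le_of_forall_dist_le (by have := Q.side_pos; positivity)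
    fun x hx y hy => dist_le_of_mem_toSet hx hy) ?_
  let x : EuclideanSpace ℝ (Fin n) := WithLp.toLp 2 fun i => Q.center i - 1 / 2 * Q.side
  let y : EuclideanSpace ℝ (Fin n) := WithLp.toLp 2 fun i => Q.center i + 1 / 2 * Q.side
  have hl := Q.side_pos
  have hx : x ∈ Q.toSet := mem_toSet_iff.2 fun i => by
    simp [x, abs_of_pos hl]
  have hy : y ∈ Q.toSet := mem_toSet_iff.2 fun i => by
    simp [y, abs_of_pos hl]
  have hb : Bornology.IsBounded Q.toSet :=
    Metric.isBounded_iff.2 ⟨_, fun _ h _ h' => dist_le_of_mem_toSet h h'⟩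
  have hxy : dist x y = √n * Q.side := by
    have h : ∀ i, dist (x i) (y i) = Q.side := fun i => by
      rw [Real.dist_eq]
      simp only [x, y]
      rw [show Q.center i - 1 / 2 * Q.side - (Q.center i + 1 / 2 * Q.side) = -Q.side by ring,
        abs_neg, abs_of_pos hl]
    rw [EuclideanSpace.dist_eq]
    simp [h, Real.sqrt_sq hl.le]
  rw [← hxy]
  exact Metric.dist_le_diam_of_mem hb hx hy

/-- Clamping each coordinate to the cube moves it by at most `7/10 - 1/2 = 1/5` of the edge. -/
theorem DyadicCube.IsNear.exists_dist_le {Q : DyadicCube n} {x : EuclideanSpace ℝ (Fin n)}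
    (h : Q.IsNear x) : ∃ q ∈ Q.toSet, dist x q ≤ 1 / 5 * (√n * Q.side) := by
  have hl := Q.side_pos
  refine ⟨WithLp.toLp 2 fun i =>
    max (Q.center i - 1 / 2 * Q.side) (min (Q.center i + 1 / 2 * Q.side) (x i)),
    mem_toSet_iff.2 fun i => ?_, ?_⟩
  · have h1 := abs_le.1 (h i)
    simp only
    rw [abs_le]
    rcases max_cases (Q.center i - 1 / 2 * Q.side) (min (Q.center i + 1 / 2 * Q.side) (x i)) with
      ⟨h2, h2'⟩ | ⟨h2, h2'⟩ <;>
    rcases min_cases (Q.center i + 1 / 2 * Q.side) (x i) with ⟨h3, h3'⟩ | ⟨h3, h3'⟩ <;>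
    constructor <;> linarith
  · rw [show 1 / 5 * (√n * Q.side) = √n * (1 / 5 * Q.side) by ring]
    refine dist_le_sqrt_mul (by positivity) fun i => ?_
    have h1 := abs_le.1 (h i)
    simp only
    rw [abs_le]
    rcases max_cases (Q.center i - 1 / 2 * Q.side) (min (Q.center i + 1 / 2 * Q.side) (x i)) with
      ⟨h2, h2'⟩ | ⟨h2, h2'⟩ <;>
    rcases min_cases (Q.center i + 1 / 2 * Q.side) (x i) with ⟨h3, h3'⟩ | ⟨h3, h3'⟩ <;>
    constructor <;> linarith

/-! ### Points near a Whitney cube: distance estimates and bounded overlap -/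

section Whitney

variable {F : Set (EuclideanSpace ℝ (Fin n))} {𝓕 : Set (DyadicCube n)} {Q : DyadicCube n}
  {x : EuclideanSpace ℝ (Fin n)}

/-- The cube is more than `1/2` diameter away from `F`, and `x` is within `1/5` diameter of the
cube: `1/2 - 1/5 = 3/10`. -/
theorem le_infDist_of_isNear (h𝓕 : 𝓕 ∈ CUBE F) (hF : F.Nonempty) (hQ : Q ∈ 𝓕)
    (hx : Q.IsNear x) : 3 / 10 * (√n * Q.side) ≤ Metric.infDist x F := by
  obtain ⟨q, hq, hxq⟩ := hx.exists_dist_le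
  have h1 := (h𝓕.2.2 Q hQ).1
  rw [diam_toSet] at h1
  refine (Metric.le_infDist hF).2 fun p hp => ?_
  have h2 : setDist Q.toSet F ≤ dist q p :=
    csInf_le ⟨0, by rintro _ ⟨a, -, b, -, rfl⟩; exact dist_nonneg⟩ ⟨q, hq, p, hp, rfl⟩
  have h3 := dist_triangle_left q p x
  linarith

theorem dist_le_of_isNear (hx : Q.IsNear x) {y : EuclideanSpace ℝ (Fin n)} (hy : y ∈ Q.toSet) :
    dist x y ≤ 6 / 5 * (√n * Q.side) := by
  obtain ⟨q, hq, hxq⟩ := hx.exists_dist_le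
  have h1 := dist_le_of_mem_toSet hq hy
  have h2 := dist_triangle x q y
  linarith

/-- Any point of the cube is within `6/5` diameter of `x`, and `F` is less than `5` diameters from
the cube: `6/5 + 5 = 31/5`. -/
theorem infDist_lt_of_isNear (h𝓕 : 𝓕 ∈ CUBE F) (hF : F.Nonempty) (hQ : Q ∈ 𝓕)
    (hx : Q.IsNear x) : Metric.infDist x F < 31 / 5 * (√n * Q.side) := by
  have h1 := (h𝓕.2.2 Q hQ).2
  rw [diam_toSet] at h1
  obtain ⟨_, ⟨q, hq, p, hp, rfl⟩, hqp⟩ :=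
    exists_lt_of_csInf_lt (Set.Nonempty.image2 ⟨_, Q.center_mem⟩ hF) h1
  have h2 := dist_le_of_isNear hx hq
  have h3 := dist_triangle x q p
  have h4 := Metric.infDist_le_dist_of_mem (x := x) hp
  linarith

theorem dist_lt_of_isNear (hx : Q.IsNear x) {p : EuclideanSpace ℝ (Fin n)}
    (hp : Metric.infDist p Q.toSet < 5 * Metric.diam Q.toSet) :
    dist x p < 31 / 5 * (√n * Q.side) := by
  obtain ⟨q, hq, hpq⟩ := (Metric.infDist_lt_iff ⟨_, Q.center_mem⟩).1 hp
  rw [diam_toSet] at hpq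
  have h2 := dist_le_of_isNear hx hq
  have h3 := dist_triangle_right x p q
  linarith

/-- A bound for the number of cubes of comparable size that are near a given point. -/
def overlapBound (n : ℕ) : ℕ :=
  (Finset.Icc (-5 : ℤ) 5 ×ˢ Fintype.piFinset fun _ : Fin n => Finset.Icc (-1 : ℤ) 1).card

open Classical in
/-- The cubes which might be near `x`, with scale comparable to `s`. -/
def candidates (s : ℤ) (x : EuclideanSpace ℝ (Fin n)) : Finset (DyadicCube n) :=
  (Finset.Icc (-5 : ℤ) 5 ×ˢ Fintype.piFinset fun _ : Fin n => Finset.Icc (-1 : ℤ) 1).image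
    fun p => ⟨s + p.1, fun i => ⌊x i / (2 : ℝ) ^ (-(s + p.1))⌋ + p.2 i⟩

theorem card_candidates_le (s : ℤ) (x : EuclideanSpace ℝ (Fin n)) :
    (candidates s x).card ≤ overlapBound n := by
  classical exact Finset.card_image_le

/-- In units of the edge, `x i` lies between `corner - 1/5` and `corner + 6/5`, so its integer part
differs from the corner by at most `1`. -/
theorem mem_candidates {s : ℤ} (hx : Q.IsNear x) (h1 : Q.scale ≤ s + 5) (h2 : s ≤ Q.scale + 5) :
    Q ∈ candidates s x := by
  classical
  refine Finset.mem_image.2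
    ⟨(Q.scale - s, fun i => Q.corner i - ⌊x i / (2 : ℝ) ^ (-Q.scale)⌋), ?_, ?_⟩
  · refine Finset.mem_product.2 ⟨Finset.mem_Icc.2 ⟨by simp only; omega, by simp only; omega⟩,
      Fintype.mem_piFinset.2 fun i => ?_⟩
    have hl := Q.side_pos
    have h := abs_le.1 (hx i)
    rw [center_apply] at h
    have h3 : x i / (2 : ℝ) ^ (-Q.scale) < (Q.corner i + 2 : ℤ) := by
      change x i / Q.side < _
      rw [div_lt_iff₀ hl]
      push_cast
      linarith
    have h4 : ((Q.corner i - 1 : ℤ) : ℝ) ≤ x i / (2 : ℝ) ^ (-Q.scale) := by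
      change _ ≤ x i / Q.side
      rw [le_div_iff₀ hl]
      push_cast
      linarith
    have h3' := Int.floor_lt.2 h3
    have h4' := Int.le_floor.2 h4
    exact Finset.mem_Icc.2 ⟨by simp only; omega, by simp only; omega⟩
  · ext <;> simp

theorem scale_le_of_side_lt {Q Q' : DyadicCube n} (h : Q'.side < 32 * Q.side) :
    Q.scale ≤ Q'.scale + 5 := by
  have h1 : (2 : ℝ) ^ (-Q'.scale) < 2 ^ (5 + -Q.scale) := by
    rw [zpow_add₀ two_ne_zero]
    norm_num
    simpa [side] using h
  have := (zpow_lt_zpow_iff_right₀ (one_lt_two : (1 : ℝ) < 2)).1 h1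
  omega

end Whitney

end Cubes

/-! ### The partition of unity -/

section Partition

open DyadicCube Topology

variable {n : ℕ} {ε : ℝ}

theorem cubeBump_eq_prod (ε : ℝ) (Q : DyadicCube n) :
    cubeBump ε Q = fun x => ∏ i, bump ε (Q.side⁻¹ * (x i - Q.center i)) := by
  ext x
  simp [cubeBump, unitBump]

theorem contDiff_cubeBump (ε : ℝ) (Q : DyadicCube n) {N : ℕ∞} :
    ContDiff ℝ N (cubeBump ε Q) := by
  rw [cubeBump_eq_prod]
  exact contDiff_prod fun i _ => (contDiff_bump ε).comp (by fun_prop)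

theorem cubeBump_nonneg (ε : ℝ) (Q : DyadicCube n) (x : EuclideanSpace ℝ (Fin n)) :
    0 ≤ cubeBump ε Q x := by
  rw [cubeBump_eq_prod]
  exact Finset.prod_nonneg fun _ _ => bump_nonneg _ _

theorem cubeBump_le_one (ε : ℝ) (Q : DyadicCube n) (x : EuclideanSpace ℝ (Fin n)) :
    cubeBump ε Q x ≤ 1 := by
  rw [cubeBump_eq_prod]
  exact Finset.prod_le_one (fun _ _ => bump_nonneg _ _) fun _ _ => bump_le_one _ _

theorem cubeBump_eq_one (hε : 0 < ε) {Q : DyadicCube n} {x : EuclideanSpace ℝ (Fin n)}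
    (hx : x ∈ Q.toSet) : cubeBump ε Q x = 1 := by
  rw [cubeBump_eq_prod]
  refine Finset.prod_eq_one fun i _ => bump_eq_one hε ?_
  rw [abs_mul, abs_of_pos (inv_pos.2 Q.side_pos), inv_mul_le_iff₀ Q.side_pos, mul_comm]
  exact mem_toSet_iff.1 hx i

theorem abs_sub_center_lt_of_cubeBump_ne_zero (hε : 0 < ε) (hε' : ε < 1 / 5) {Q : DyadicCube n}
    {x : EuclideanSpace ℝ (Fin n)} (hx : cubeBump ε Q x ≠ 0) (i : Fin n) :
    |x i - Q.center i| < 3 / 5 * Q.side := by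
  by_contra! h
  refine hx ?_
  rw [cubeBump_eq_prod]
  refine Finset.prod_eq_zero (Finset.mem_univ i) (bump_eq_zero hε hε' ?_)
  rwa [abs_mul, abs_of_pos (inv_pos.2 Q.side_pos), le_inv_mul_iff₀ Q.side_pos, mul_comm]

/-- All `φ_Q` are rescaled copies of one function; measured at the scale of the edge, one constant
serves every cube and every point. -/
theorem exists_derivBound_cubeBump (n : ℕ) (hε : 0 < ε) (hε' : ε < 1 / 5) (N : ℕ) :
    ∃ C : ℝ, ∀ (Q : DyadicCube n) (x), DerivBound N Q.side C (cubeBump ε Q) x := by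
  obtain ⟨B, hB⟩ := exists_norm_iteratedFDeriv_bump_le hε hε' N
  refine ⟨∏ _i : Fin n, (2 ^ N * (N.factorial * B * 1 ^ N)), fun Q x => ?_⟩
  have hl := Q.side_pos
  rw [cubeBump_eq_prod]
  refine DerivBound.prod Finset.univ hl.le fun i _ => ?_
  refine DerivBound.comp (contDiff_bump ε) hl (by fun_prop) (fun j hj _ => ?_) le_rfl
    fun k hk => hB k hk _
  have h := norm_iteratedFDeriv_affine_le (ρ := Q.side) (A := 1) (x := x)
    (Q.side⁻¹ • EuclideanSpace.proj i : EuclideanSpace ℝ (Fin n) →L[ℝ] ℝ)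
    (-(Q.side⁻¹ * Q.center i)) zero_le_one ?_ hj
  · convert h using 5
    simp [sub_eq_add_neg, mul_add]
  · rw [norm_smul, norm_inv, Real.norm_of_nonneg hl.le, mul_right_comm, inv_mul_cancel₀ hl.ne',
      one_mul]
    exact norm_proj_le i

variable {F : Set (EuclideanSpace ℝ (Fin n))} {𝓕 : Set (DyadicCube n)}
  {x : EuclideanSpace ℝ (Fin n)}

/-- Supports lie within `3/5` of the edge from the center, nearness allows `7/10`; the margin of
`1/10` makes the cubes near `x` account for all bumps alive in a whole neighborhood of `x`. -/
theorem exists_finset_cubeBump (hε : 0 < ε) (hε' : ε < 1 / 5) (hF : IsClosed F)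
    (hF₀ : F.Nonempty) (h𝓕 : 𝓕 ∈ CUBE F) (hx : x ∉ F) :
    ∃ t : Finset (DyadicCube n), (∀ Q ∈ t, Q ∈ 𝓕 ∧ Q.IsNear x) ∧ t.card ≤ overlapBound n ∧
      ∀ᶠ y in 𝓝 x, ∀ Q ∈ 𝓕, Q ∉ t → cubeBump ε Q y = 0 := by
  classical
  have hδ : 0 < Metric.infDist x F := (hF.notMem_iff_infDist_pos hF₀).1 hx
  set δ := Metric.infDist x F
  have hx' : x ∈ ⋃ Q ∈ 𝓕, Q.toSet := by rw [h𝓕.1]; exact hx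
  simp only [Set.mem_iUnion] at hx'
  obtain ⟨Q₀, hQ₀, hxQ₀⟩ := hx'
  have hnear₀ : Q₀.IsNear x := fun i => by
    have := mem_toSet_iff.1 hxQ₀ i
    have := Q₀.side_pos
    linarith
  -- If `n = 0`, the strict upper bound for the positive distance to `F` would read `< 0`.
  have hn : 0 < √n := by
    have := infDist_lt_of_isNear h𝓕 hF₀ hQ₀ hnear₀
    refine (Real.sqrt_nonneg _).lt_of_ne fun h => ?_
    rw [← h] at this
    linarith
  have hcomp : ∀ Q ∈ 𝓕, ∀ Q' ∈ 𝓕, Q.IsNear x → Q'.IsNear x → Q.scale ≤ Q'.scale + 5 := by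
    intro Q hQ Q' hQ' h h'
    refine scale_le_of_side_lt ?_
    have h1 := le_infDist_of_isNear h𝓕 hF₀ hQ' h'
    have h2 := infDist_lt_of_isNear h𝓕 hF₀ hQ h
    have h3 := Q.side_pos
    -- Both edges are comparable to `δ`, with ratio below `(31/5) / (3/10) = 62/3 < 32 = 2 ^ 5`.
    have h4 : √n * Q'.side < √n * (32 * Q.side) := by nlinarith
    exact lt_of_mul_lt_mul_left h4 hn.le
  refine ⟨(candidates Q₀.scale x).filter fun Q => Q ∈ 𝓕 ∧ Q.IsNear x,
    fun Q hQ => (Finset.mem_filter.1 hQ).2,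
    (Finset.card_filter_le _ _).trans (card_candidates_le _ _), ?_⟩
  -- The first radius gives `δ < (62/5) √n l` for any cube of edge `l` whose bump is nonzero at `y`;
  -- the second then gives `d(y,x) ≤ l / 10`.
  have hη : 0 < min (δ / 2) (δ / (124 * √n)) := by positivity
  filter_upwards [Metric.ball_mem_nhds x hη] with y hy Q hQ hQt
  rw [Metric.mem_ball, lt_min_iff, lt_div_iff₀ two_pos,
    lt_div_iff₀ (by positivity)] at hy
  by_contra hne
  have hyQ := abs_sub_center_lt_of_cubeBump_ne_zero hε hε' hne
  have hl := Q.side_pos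
  have h1 := infDist_lt_of_isNear h𝓕 hF₀ hQ (x := y) fun i => by linarith [hyQ i]
  have h2 : δ ≤ Metric.infDist y F + dist x y := Metric.infDist_le_infDist_add_dist
  rw [dist_comm] at h2
  have h3 : dist y x ≤ 1 / 10 * Q.side := by
    have : √n * dist y x ≤ √n * (1 / 10 * Q.side) := by linarith
    exact le_of_mul_le_mul_left this hn
  have hnear : Q.IsNear x := fun i => by
    have h4 := abs_le.1 (abs_apply_sub_le y x i)
    have h5 := abs_lt.1 (hyQ i)
    exact abs_le.2 ⟨by linarith, by linarith⟩
  refine hQt (Finset.mem_filter.2 ⟨mem_candidates hnear ?_ ?_, hQ, hnear⟩)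
  · exact hcomp Q hQ Q₀ hQ₀ hnear hnear₀
  · exact hcomp Q₀ hQ₀ Q hQ hnear₀ hnear

/-- A smooth function on the line that equals `s⁻¹` for `s ≥ 1`. -/
def smoothInv (s : ℝ) : ℝ := (1 + (s - 1) * Real.smoothTransition (2 * s))⁻¹

theorem smoothInv_eq_inv {s : ℝ} (hs : 1 ≤ s) : smoothInv s = s⁻¹ := by
  rw [smoothInv, Real.smoothTransition.one_of_one_le (by linarith)]
  ring_nf

/-- The denominator is the convex combination of `1` and `s` with weight `χ = smoothTransition (2 *
s)` on `s`; that weight vanishes for `s ≤ 0`, so it stays positive. Global smoothness is needed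
because `DerivBound` asks for functions smooth everywhere, while the sum of bumps is at least `1`
only near `x`. -/
theorem contDiff_smoothInv {N : ℕ∞} : ContDiff ℝ N smoothInv := by
  have h : ContDiff ℝ N Real.smoothTransition := Real.smoothTransition.contDiff
  refine ContDiff.inv (contDiff_const.add
    ((contDiff_id.sub contDiff_const).mul (h.comp (by fun_prop)))) fun s => ne_of_gt ?_
  have h0 := Real.smoothTransition.nonneg (2 * s)
  have h1 := Real.smoothTransition.le_one (2 * s)
  rcases le_or_gt s 0 with hs | hs
  · rw [Real.smoothTransition.zero_of_nonpos (by linarith)]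
    norm_num
  · have := mul_pos hs (Real.smoothTransition.pos_of_pos (x := 2 * s) (by linarith))
    linarith

theorem exists_norm_iteratedFDeriv_smoothInv_le (N : ℕ) (R : ℝ) :
    ∃ B : ℝ, ∀ i ≤ N, ∀ s ∈ Set.Icc 0 R, ‖iteratedFDeriv ℝ i smoothInv s‖ ≤ B := by
  have : ∀ i, ∃ B : ℝ, ∀ s ∈ Set.Icc 0 R, ‖iteratedFDeriv ℝ i smoothInv s‖ ≤ B := fun i =>
    isCompact_Icc.exists_bound_of_continuousOn
      ((contDiff_smoothInv (N := i)).continuous_iteratedFDeriv le_rfl).continuousOn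
  choose B hB using this
  refine ⟨∑ i ∈ Finset.range (N + 1), |B i|,
    fun i hi s hs => (hB i s hs).trans ((le_abs_self _).trans ?_)⟩
  exact Finset.single_le_sum (f := fun i => |B i|) (fun _ _ => abs_nonneg _)
    (Finset.mem_range.2 (Nat.lt_succ_of_le hi))

theorem finsum_coe_eq_sum {α : Type*} {s : Set α} {t : Finset α} (hts : ∀ a ∈ t, a ∈ s)
    {h : α → ℝ} (h0 : ∀ a ∈ s, a ∉ t → h a = 0) : ∑ᶠ a : s, h a = ∑ a ∈ t, h a := by
  rw [finsum_set_coe_eq_finsum_mem (s := s) (f := h)]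
  refine finsum_mem_eq_sum_of_inter_support_eq h (Set.ext fun a => ?_)
  simp only [Set.mem_inter_iff, Function.mem_support, Finset.mem_coe]
  constructor
  · rintro ⟨h1, h2⟩
    exact ⟨by_contra fun h3 => h2 (h0 a h1 h3), h2⟩
  · rintro ⟨h1, h2⟩
    exact ⟨hts a h1, h2⟩

theorem eventually_one_le_sum_cubeBump (hε : 0 < ε) (hF : IsClosed F) (h𝓕 : 𝓕 ∈ CUBE F)
    (hx : x ∉ F) {t : Finset (DyadicCube n)}
    (ht0 : ∀ᶠ y in 𝓝 x, ∀ Q ∈ 𝓕, Q ∉ t → cubeBump ε Q y = 0) :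
    ∀ᶠ y in 𝓝 x, 1 ≤ ∑ Q ∈ t, cubeBump ε Q y := by
  filter_upwards [hF.isOpen_compl.mem_nhds hx, ht0] with y hy hy0
  rw [← h𝓕.1] at hy
  simp only [Set.mem_iUnion] at hy
  obtain ⟨Q, hQ, hyQ⟩ := hy
  have h1 := cubeBump_eq_one hε hyQ
  have hQt : Q ∈ t := by
    by_contra h
    rw [hy0 Q hQ h] at h1
    exact zero_ne_one h1
  rw [← h1]
  exact Finset.single_le_sum (f := fun Q => cubeBump ε Q y) (fun Q _ => cubeBump_nonneg ε Q y) hQt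

/-- Off `F`, the extension is locally a finite sum. -/
theorem extension_eventuallyEq (hε : 0 < ε) (hF : IsClosed F) (h𝓕 : 𝓕 ∈ CUBE F) (m : ℕ)
    (f : (Fin n → ℕ) → EuclideanSpace ℝ (Fin n) → ℝ)
    (r : DyadicCube n → EuclideanSpace ℝ (Fin n)) (hx : x ∉ F)
    {t : Finset (DyadicCube n)} (ht : ∀ Q ∈ t, Q ∈ 𝓕)
    (ht0 : ∀ᶠ y in 𝓝 x, ∀ Q ∈ 𝓕, Q ∉ t → cubeBump ε Q y = 0) :
    extension ε m F f 𝓕 r =ᶠ[𝓝 x] fun y => ∑ Q ∈ t, taylorPoly m f 0 (r Q) y *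
      (cubeBump ε Q y * smoothInv (∑ Q' ∈ t, cubeBump ε Q' y)) := by
  filter_upwards [hF.isOpen_compl.mem_nhds hx, ht0,
    eventually_one_le_sum_cubeBump hε hF h𝓕 hx ht0] with y hy hy0 hy1
  have hS : ∑ᶠ Q' : 𝓕, cubeBump ε Q'.1 y = ∑ Q ∈ t, cubeBump ε Q y :=
    finsum_coe_eq_sum (h := fun Q => cubeBump ε Q y) ht hy0
  rw [extension, if_neg hy, finsum_coe_eq_sum
    (h := fun Q => taylorPoly m f 0 (r Q) y * normalizedBump ε 𝓕 Q y) ht fun Q hQ hQt => by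
      simp [normalizedBump, hy0 Q hQ hQt]]
  refine Finset.sum_congr rfl fun Q _ => ?_
  rw [normalizedBump, hS, smoothInv_eq_inv hy1, div_eq_mul_inv]

theorem contDiffAt_extension (hε : 0 < ε) (hε' : ε < 1 / 5) (hF : IsClosed F)
    (hF₀ : F.Nonempty) (h𝓕 : 𝓕 ∈ CUBE F) (m : ℕ)
    (f : (Fin n → ℕ) → EuclideanSpace ℝ (Fin n) → ℝ)
    (r : DyadicCube n → EuclideanSpace ℝ (Fin n)) (hx : x ∉ F) {N : ℕ∞} :
    ContDiffAt ℝ N (extension ε m F f 𝓕 r) x := by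
  obtain ⟨t, ht, -, ht0⟩ := exists_finset_cubeBump hε hε' hF hF₀ h𝓕 hx
  refine ContDiffAt.congr_of_eventuallyEq (ContDiff.contDiffAt ?_)
    (extension_eventuallyEq hε hF h𝓕 m f r hx (fun Q hQ => (ht Q hQ).1) ht0)
  exact ContDiff.sum fun Q _ => (contDiff_taylorPoly m f 0 (r Q)).mul
    ((contDiff_cubeBump ε Q).mul (contDiff_smoothInv.comp
      (ContDiff.sum fun Q' _ => contDiff_cubeBump ε Q')))

end Partition

/-! ### Estimates for the extension -/

section Estimates

open DyadicCube Topology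

variable {n : ℕ} {ε : ℝ}

theorem DerivBound.norm_iteratedFDeriv_le {E : Type*} [NormedAddCommGroup E] [NormedSpace ℝ E]
    {m : ℕ} {ρ C : ℝ} {f : E → ℝ} {x : E} (h : DerivBound m ρ (C * ρ ^ (m + 1)) f x) (hρ : 0 < ρ)
    {j : ℕ} (hj : j ≤ m) : ‖iteratedFDeriv ℝ j f x‖ ≤ C * ρ ^ (m + 1 - j) := by
  have h1 := h.2 j hj
  rw [show ρ ^ (m + 1) = ρ ^ (m + 1 - j) * ρ ^ j by rw [← pow_add]; congr 1; omega,
    ← mul_assoc] at h1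
  exact le_of_mul_le_mul_right h1 (by positivity)

variable {F : Set (EuclideanSpace ℝ (Fin n))} {𝓕 : Set (DyadicCube n)}

/-- The witness `h` is `∑ (P_{r_Q} - P_a) φ*_Q` over the cubes near `x`, with the inverse replaced
by `smoothInv`. The constant is independent of `x` because the number of cubes is. -/
theorem exists_derivBound_extension_sub (hε : 0 < ε) (hε' : ε < 1 / 5) (hF : IsClosed F)
    (hF₀ : F.Nonempty) (h𝓕 : 𝓕 ∈ CUBE F) {m : ℕ}
    {f : (Fin n → ℕ) → EuclideanSpace ℝ (Fin n) → ℝ} (hf : IsWhitneyJet m F f)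
    {r : DyadicCube n → EuclideanSpace ℝ (Fin n)}
    (hr : ∀ Q ∈ 𝓕, r Q ∈ F ∧ Metric.infDist (r Q) Q.toSet < 5 * Metric.diam Q.toSet) :
    ∃ C : ℝ, 0 ≤ C ∧ ∀ x ∉ F, ∀ a ∈ F, dist x a = Metric.infDist x F →
      ∃ h : EuclideanSpace ℝ (Fin n) → ℝ,
        DerivBound m (22 * dist x a) (C * (22 * dist x a) ^ (m + 1)) h x ∧
        extension ε m F f 𝓕 r =ᶠ[𝓝 x] fun y => h y + taylorPoly m f 0 a y := by
  obtain ⟨C₁, hC₁, hP⟩ := hf.exists_derivBound_sub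
  obtain ⟨C₂, hφ⟩ := exists_derivBound_cubeBump n hε hε' m
  obtain ⟨C₃, hw⟩ := exists_norm_iteratedFDeriv_smoothInv_le m (overlapBound n)
  -- Chosen so that `ρ ≤ c l` for each edge `l`: `22 * 31/5 = 136.4 < 137`. The `1` ensures `1 ≤ c`.
  set c : ℝ := 137 * √n + 1 with hc
  have hc1 : 1 ≤ c := by have := Real.sqrt_nonneg (n : ℝ); linarith
  have hC₂ : 0 ≤ C₂ := (hφ ⟨0, 0⟩ 0).nonneg
  have hC₃ : 0 ≤ C₃ := (norm_nonneg _).trans (hw 0 (Nat.zero_le _) 0 ⟨le_rfl, by positivity⟩)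
  set A : ℝ := overlapBound n * (c ^ m * C₂) + 1
  have hA : 1 ≤ A := by
    have : 0 ≤ overlapBound n * (c ^ m * C₂) := by positivity
    linarith
  set K : ℝ := 2 ^ m * (C₁ * (2 ^ m * ((c ^ m * C₂) * (m.factorial * C₃ * A ^ m)))) with hK
  have hK0 : 0 ≤ K := by positivity
  refine ⟨overlapBound n * K, by positivity, fun x hx a ha hxa => ?_⟩
  have hδ : 0 < Metric.infDist x F := (hF.notMem_iff_infDist_pos hF₀).1 hx
  rw [← hxa] at hδ
  obtain ⟨t, ht, htcard, ht0⟩ := exists_finset_cubeBump hε hε' hF hF₀ h𝓕 hx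
  have htcard' : (t.card : ℝ) ≤ overlapBound n := by exact_mod_cast htcard
  have hS1 := eventually_one_le_sum_cubeBump hε hF h𝓕 hx ht0
  -- Near cubes give `d(x, r_Q) < (31/5)(10/3) d(x,a) = (62/3) d(x,a)`, hence `d(r_Q, a) < (65/3)
  -- d(x,a)`; `22` exceeds both factors.
  set ρ := 22 * dist x a with hρ
  have hρ0 : 0 < ρ := by positivity
  have hφρ : ∀ Q ∈ t, DerivBound m ρ (c ^ m * C₂) (cubeBump ε Q) x := fun Q hQ => by
    refine (hφ Q x).rescale hρ0.le Q.side_pos.le hc1 ?_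
    have h1 := infDist_lt_of_isNear h𝓕 hF₀ (ht Q hQ).1 (ht Q hQ).2
    have h2 := mul_nonneg (Real.sqrt_nonneg (n : ℝ)) Q.side_pos.le
    have h3 := Q.side_pos
    rw [hρ, hc, hxa]
    linarith
  have hPρ : ∀ Q ∈ t, DerivBound m ρ (C₁ * ρ ^ (m + 1))
      (fun y => taylorPoly m f 0 (r Q) y - taylorPoly m f 0 a y) x := fun Q hQ => by
    have h1 := le_infDist_of_isNear h𝓕 hF₀ (ht Q hQ).1 (ht Q hQ).2
    have h2 := dist_lt_of_isNear (ht Q hQ).2 (hr Q (ht Q hQ).1).2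
    have h3 := dist_triangle_left (r Q) a x
    rw [← hxa] at h1
    refine hP _ (hr Q (ht Q hQ).1).1 a ha x ρ hρ0.le ?_ ?_ <;> rw [hρ] <;> linarith
  have hSρ : DerivBound m ρ A (fun y => ∑ Q ∈ t, cubeBump ε Q y) x := by
    refine (DerivBound.sum t hρ0.le hφρ).mono ?_
    rw [Finset.sum_const, nsmul_eq_mul]
    have : (t.card : ℝ) * (c ^ m * C₂) ≤ overlapBound n * (c ^ m * C₂) := by gcongr
    linarith
  have hwρ : DerivBound m ρ (m.factorial * C₃ * A ^ m)
      (fun y => smoothInv (∑ Q ∈ t, cubeBump ε Q y)) x := by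
    refine DerivBound.comp contDiff_smoothInv hρ0 hSρ.1 (fun j _ hj => hSρ.2 j hj) hA
      fun i hi => hw i hi _ ⟨Finset.sum_nonneg fun Q _ => cubeBump_nonneg ε Q x, ?_⟩
    refine (Finset.sum_le_card_nsmul t _ 1 fun Q _ => cubeBump_le_one ε Q x).trans ?_
    simpa using htcard'
  refine ⟨fun y => ∑ Q ∈ t, (taylorPoly m f 0 (r Q) y - taylorPoly m f 0 a y) *
    (cubeBump ε Q y * smoothInv (∑ Q' ∈ t, cubeBump ε Q' y)), ?_, ?_⟩
  · refine (DerivBound.sum t hρ0.le fun Q hQ =>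
      (hPρ Q hQ).mul hρ0.le ((hφρ Q hQ).mul hρ0.le hwρ)).mono ?_
    rw [Finset.sum_const, nsmul_eq_mul]
    calc _ = t.card * (K * ρ ^ (m + 1)) := by rw [hK]; ring
      _ ≤ overlapBound n * (K * ρ ^ (m + 1)) := by gcongr
      _ = _ := by ring
  · filter_upwards [extension_eventuallyEq hε hF h𝓕 m f r hx (fun Q hQ => (ht Q hQ).1) ht0,
      hS1] with y hy hy1
    rw [hy]
    simp_rw [sub_mul]
    rw [Finset.sum_sub_distrib, ← Finset.mul_sum, ← Finset.sum_mul, smoothInv_eq_inv hy1,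
      mul_inv_cancel₀ (by linarith), mul_one, sub_add_cancel]

/-- Pass through a nearest point `b`: `g - P_a = (g - P_b) + (P_b - P_a)`, with `d(x,b) ≤ d(x,a)`
and `d(b,a) ≤ 2 d(x,a)`. -/
theorem exists_norm_iteratedFDeriv_extension_sub_le (hε : 0 < ε) (hε' : ε < 1 / 5)
    (hF : IsClosed F) (hF₀ : F.Nonempty) (h𝓕 : 𝓕 ∈ CUBE F) {m : ℕ}
    {f : (Fin n → ℕ) → EuclideanSpace ℝ (Fin n) → ℝ} (hf : IsWhitneyJet m F f)
    {r : DyadicCube n → EuclideanSpace ℝ (Fin n)}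
    (hr : ∀ Q ∈ 𝓕, r Q ∈ F ∧ Metric.infDist (r Q) Q.toSet < 5 * Metric.diam Q.toSet) :
    ∃ C : ℝ, 0 ≤ C ∧ ∀ x ∉ F, ∀ a ∈ F, ∀ j ≤ m,
      ‖iteratedFDeriv ℝ j (extension ε m F f 𝓕 r) x - iteratedFDeriv ℝ j (taylorPoly m f 0 a) x‖
        ≤ C * (22 * dist x a) ^ (m + 1 - j) := by
  obtain ⟨C₁, hC₁, h₁⟩ := exists_derivBound_extension_sub hε hε' hF hF₀ h𝓕 hf hr
  obtain ⟨C₂, hC₂, h₂⟩ := hf.exists_derivBound_sub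
  refine ⟨C₁ + C₂, by positivity, fun x hx a ha j hj => ?_⟩
  obtain ⟨b, hb, hxb⟩ := hF.exists_infDist_eq_dist hF₀ x
  have hδ : 0 < Metric.infDist x F := (hF.notMem_iff_infDist_pos hF₀).1 hx
  have hba : dist x b ≤ dist x a := hxb ▸ Metric.infDist_le_dist_of_mem ha
  rw [hxb] at hδ
  obtain ⟨h, hh, hg⟩ := h₁ x hx b hb hxb.symm
  have hsub := h₂ b hb a ha x (22 * dist x a) (by positivity) (by linarith)
    (by have := dist_triangle_left b a x; linarith)
  have hj' : (j : WithTop ℕ∞) ≤ m := by exact_mod_cast hj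
  have e : iteratedFDeriv ℝ j (extension ε m F f 𝓕 r) x -
      iteratedFDeriv ℝ j (taylorPoly m f 0 a) x = iteratedFDeriv ℝ j h x +
        iteratedFDeriv ℝ j (fun y => taylorPoly m f 0 b y - taylorPoly m f 0 a y) x := by
    have e1 : iteratedFDeriv ℝ j (fun y => h y + taylorPoly m f 0 b y) x =
        iteratedFDeriv ℝ j h x + iteratedFDeriv ℝ j (taylorPoly m f 0 b) x :=
      iteratedFDeriv_add_apply (hh.1.contDiffAt.of_le hj') (contDiff_taylorPoly m f 0 b).contDiffAt
    have e2 : iteratedFDeriv ℝ j (fun y => taylorPoly m f 0 b y - taylorPoly m f 0 a y) x =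
        iteratedFDeriv ℝ j (taylorPoly m f 0 b) x - iteratedFDeriv ℝ j (taylorPoly m f 0 a) x :=
      iteratedFDeriv_sub_apply (contDiff_taylorPoly m f 0 b).contDiffAt
        (contDiff_taylorPoly m f 0 a).contDiffAt
    rw [(hg.iteratedFDeriv ℝ j).eq_of_nhds, e1, e2]
    abel
  rw [e, add_mul]
  refine (norm_add_le _ _).trans (add_le_add ?_ (hsub.norm_iteratedFDeriv_le (by linarith) hj))
  refine (hh.norm_iteratedFDeriv_le (by positivity) hj).trans ?_
  gcongr

/-! ### The candidate Taylor series and smoothness across `F` -/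

open Classical in
/-- The Taylor series of the extension: on `F` it is that of the Taylor polynomials of the jet. -/
def extensionSeries (ε : ℝ) (m : ℕ) (F : Set (EuclideanSpace ℝ (Fin n)))
    (f : (Fin n → ℕ) → EuclideanSpace ℝ (Fin n) → ℝ) (𝓕 : Set (DyadicCube n))
    (r : DyadicCube n → EuclideanSpace ℝ (Fin n)) (x : EuclideanSpace ℝ (Fin n)) :
    FormalMultilinearSeries ℝ (EuclideanSpace ℝ (Fin n)) ℝ :=
  if x ∈ F then ftaylorSeries ℝ (taylorPoly m f 0 x) x
  else ftaylorSeries ℝ (extension ε m F f 𝓕 r) x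

theorem exists_norm_extensionSeries_sub_le (hε : 0 < ε) (hε' : ε < 1 / 5)
    (hF : IsClosed F) (hF₀ : F.Nonempty) (h𝓕 : 𝓕 ∈ CUBE F) {m : ℕ}
    {f : (Fin n → ℕ) → EuclideanSpace ℝ (Fin n) → ℝ} (hf : IsWhitneyJet m F f)
    {r : DyadicCube n → EuclideanSpace ℝ (Fin n)}
    (hr : ∀ Q ∈ 𝓕, r Q ∈ F ∧ Metric.infDist (r Q) Q.toSet < 5 * Metric.diam Q.toSet) :
    ∃ C : ℝ, ∀ x, ∀ a ∈ F, ∀ j ≤ m,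
      ‖extensionSeries ε m F f 𝓕 r x j - iteratedFDeriv ℝ j (taylorPoly m f 0 a) x‖
        ≤ C * (22 * dist x a) ^ (m + 1 - j) := by
  obtain ⟨C₁, hC₁, h₁⟩ := exists_norm_iteratedFDeriv_extension_sub_le hε hε' hF hF₀ h𝓕 hf hr
  obtain ⟨C₂, hC₂, h₂⟩ := hf.exists_derivBound_sub
  refine ⟨C₁ + C₂, fun x a ha j hj => ?_⟩
  by_cases hx : x ∈ F
  · rw [extensionSeries, if_pos hx]
    rcases eq_or_ne x a with rfl | hxa
    · rw [ftaylorSeries, sub_self, norm_zero]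
      positivity
    · have hd := dist_pos.2 hxa
      have h := (h₂ x hx a ha x (22 * dist x a) (by positivity) (by simp)
        (by linarith)).norm_iteratedFDeriv_le (by positivity) hj
      have e2 : iteratedFDeriv ℝ j (fun y => taylorPoly m f 0 x y - taylorPoly m f 0 a y) x =
          iteratedFDeriv ℝ j (taylorPoly m f 0 x) x - iteratedFDeriv ℝ j (taylorPoly m f 0 a) x :=
        iteratedFDeriv_sub_apply (contDiff_taylorPoly m f 0 x).contDiffAt
          (contDiff_taylorPoly m f 0 a).contDiffAt
      rw [e2] at h
      refine h.trans ?_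
      gcongr
      linarith
  · rw [extensionSeries, if_neg hx]
    refine (h₁ x hx a ha j hj).trans ?_
    gcongr
    linarith

theorem taylorPoly_zero_self (m : ℕ) (f : (Fin n → ℕ) → EuclideanSpace ℝ (Fin n) → ℝ)
    (a : EuclideanSpace ℝ (Fin n)) : taylorPoly m f 0 a a = f 0 a := by
  have h : iteratedPartialDeriv 0 (taylorPoly m f 0 a) = taylorPoly m f 0 a := by
    simp [iteratedPartialDeriv]
  rw [← iteratedPartialDeriv_taylorPoly_self f (m := m) (k := 0) (by simp [order]) a, h]

theorem hasFTaylorSeriesUpTo_extension (hε : 0 < ε) (hε' : ε < 1 / 5)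
    (hF : IsClosed F) (hF₀ : F.Nonempty) (h𝓕 : 𝓕 ∈ CUBE F) {m : ℕ}
    {f : (Fin n → ℕ) → EuclideanSpace ℝ (Fin n) → ℝ} (hf : IsWhitneyJet m F f)
    {r : DyadicCube n → EuclideanSpace ℝ (Fin n)}
    (hr : ∀ Q ∈ 𝓕, r Q ∈ F ∧ Metric.infDist (r Q) Q.toSet < 5 * Metric.diam Q.toSet) :
    HasFTaylorSeriesUpTo m (extension ε m F f 𝓕 r) (extensionSeries ε m F f 𝓕 r) := by
  obtain ⟨C, hC⟩ := exists_norm_extensionSeries_sub_le hε hε' hF hF₀ h𝓕 hf hr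
  have hoff : ∀ x ∉ F, ∀ j, (fun y => extensionSeries ε m F f 𝓕 r y j) =ᶠ[𝓝 x]
      iteratedFDeriv ℝ j (extension ε m F f 𝓕 r) := fun x hx j => by
    filter_upwards [hF.isOpen_compl.mem_nhds hx] with y hy
    rw [extensionSeries, if_neg hy, ftaylorSeries]
  refine ⟨fun x => ?_, fun j hj x => ?_, fun j hj => continuous_iff_continuousAt.2 fun x => ?_⟩
  · by_cases hx : x ∈ F
    · rw [extensionSeries, if_pos hx, extension, if_pos hx, ← taylorPoly_zero_self m f x]
      rfl
    · rw [extensionSeries, if_neg hx]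
      rfl
  · have hj' : j < m := by exact_mod_cast hj
    by_cases hx : x ∈ F
    -- The difference is `O(|y - x| ^ (m + 1 - j))` with exponent greater than `1`, so its
    -- derivative at `x` is zero and the candidate inherits the derivative of `D^j P_x`.
    · have h1 : HasFDerivAt (fun y => extensionSeries ε m F f 𝓕 r y j -
          iteratedFDeriv ℝ j (taylorPoly m f 0 x) y)
          (0 : EuclideanSpace ℝ (Fin n) →L[ℝ] _) x := by
        refine Asymptotics.IsBigO.hasFDerivAt (n := m + 1 - j)
          (Asymptotics.IsBigO.of_bound (C * 22 ^ (m + 1 - j)) (Filter.Eventually.of_forall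
            fun y => ?_)) (by omega)
        rw [norm_pow, norm_norm, ← dist_eq_norm y x, mul_assoc, ← mul_pow]
        exact hC y x hx j hj'.le
      have h2 : HasFDerivAt (iteratedFDeriv ℝ j (taylorPoly m f 0 x))
          (extensionSeries ε m F f 𝓕 r x j.succ).curryLeft x := by
        rw [extensionSeries, if_pos hx]
        exact ((contDiff_taylorPoly m f 0 x (N := m)).differentiable_iteratedFDeriv
          hj).differentiableAt.hasFDerivAt
      have h3 := h1.fun_add h2
      simpa only [sub_add_cancel, zero_add] using h3
    · refine HasFDerivAt.congr_of_eventuallyEq ?_ (hoff x hx j)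
      rw [extensionSeries, if_neg hx]
      exact ((contDiffAt_extension hε hε' hF hF₀ h𝓕 m f r hx
        (N := m)).differentiableAt_iteratedFDeriv hj).hasFDerivAt
  · have hj' : j ≤ m := by exact_mod_cast hj
    by_cases hx : x ∈ F
    · have h1 : Filter.Tendsto (fun y => extensionSeries ε m F f 𝓕 r y j -
          iteratedFDeriv ℝ j (taylorPoly m f 0 x) y) (𝓝 x) (𝓝 0) := by
        refine squeeze_zero_norm (fun y => hC y x hx j hj') ?_
        have : Continuous fun y => C * (22 * dist y x) ^ (m + 1 - j) := by fun_prop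
        have h0 := this.tendsto x
        rwa [dist_self, mul_zero, zero_pow (by omega), mul_zero] at h0
      have h2 := ((contDiff_taylorPoly m f 0 x (N := m)).continuous_iteratedFDeriv hj).tendsto x
      have h3 := h1.add h2
      simp only [sub_add_cancel, zero_add] at h3
      rw [ContinuousAt]
      convert h3 using 2
      rw [extensionSeries, if_pos hx, ftaylorSeries]
    · refine ContinuousAt.congr ?_ (hoff x hx j).symm
      -- One order more than `m` is used: continuity of the `j`-th derivative is obtained from its
      -- differentiability, and `j = m` is allowed.
      exact ((contDiffAt_extension hε hε' hF hF₀ h𝓕 m f r hx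
        (N := (m + 1 : ℕ))).differentiableAt_iteratedFDeriv
          (by exact_mod_cast Nat.lt_succ_of_le hj')).continuousAt

end Estimates

end

end WhitneyExtension

theorem mainTheorem3 {n : ℕ} (m : ℕ) (ε : ℝ) (hε₀ : 0 < ε) (hε : ε < 1 / 5)
    (F : Set (EuclideanSpace ℝ (Fin n))) (hF : IsClosed F) (hF₀ : F.Nonempty)
    (f : (Fin n → ℕ) → EuclideanSpace ℝ (Fin n) → ℝ)
    (hf : WhitneyExtension.IsWhitneyJet m F f)
    (g : EuclideanSpace ℝ (Fin n) → ℝ) (hg : g ∈ WhitneyExtension.WET ε m F f) :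
    ContDiff ℝ m g ∧
    (∀ k : Fin n → ℕ, WhitneyExtension.order k ≤ m →
      ∀ x ∈ F, WhitneyExtension.iteratedPartialDeriv k g x = f k x) ∧
    ContDiffOn ℝ ∞ g Fᶜ := by
  open WhitneyExtension in
  obtain ⟨𝓕, h𝓕, r, hr, rfl⟩ := hg
  have hT := hasFTaylorSeriesUpTo_extension hε₀ hε hF hF₀ h𝓕 hf hr
  have hg : ContDiff ℝ m (extension ε m F f 𝓕 r) := hT.contDiff
  refine ⟨hg, fun k hk x hx => ?_, fun x hx =>
    (contDiffAt_extension hε₀ hε hF hF₀ h𝓕 m f r hx).contDiffWithinAt⟩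
  have hk' : (order k : WithTop ℕ∞) ≤ m := by exact_mod_cast hk
  obtain ⟨v, hv⟩ := isDerivEval_iteratedPartialDeriv k
  -- Both sides become `order k`-th derivatives at `x` evaluated at the same tuple `v`, and on `F`
  -- the Taylor series of `g` is that of `P_x`.
  rw [← iteratedPartialDeriv_taylorPoly_self f hk x, hv _ (hg.of_le hk'),
    hv _ (contDiff_taylorPoly m f 0 x)]
  beta_reduce
  rw [← hT.eq_iteratedFDeriv hk' x, extensionSeries, if_pos hx, ftaylorSeries]
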